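/- Let $Z_\infty=(X^+,X^-)$ be the planar piecewise smooth vector field $$X^+(x,y)=(1,\,2\sin(2\pi x))\ \text{ for } y\ge 0,\qquad X^-(x,y)=(-1,\,2\sin(2\pi x))\ \text{ for } y\le 0,$$ with switching manifold $\{y=0\}$. Put $P(x)=\frac1\pi(1-\cos 2\pi x)$, so that the graphs of $P$ and $-P$ are the orbits of $X^+$ and $X^-$ through the visible-visible two-folds $p_j=(j,0)$, $j\in\mathbb Z$; let $\Lambda_\infty$ be the union of the two graphs, and for $j\in\mathbb Z$ let $I_{2j}$ and $I_{2j+1}$ be the open arcs of the graphs of $P$ and of $-P$ over $(j,j+1)$. Let $\Omega_\infty$ be the set of positive global trajectories $\gamma:[0,\infty)\to\mathbb R^2$ of $Z_\infty$ with $\gamma(0)\in\Lambda_\infty$. A global trajectory is a concatenation of local ones: off the switching manifold it follows $X^\pm$; at a crossing point it passes from one field to the other; at a regular tangency it follows either field before and either field after; at a singular (invisible-invisible) tangency it is constant. The itinerary $s(\gamma)=(s_j(\gamma))_{j\in\mathbb N}\in\mathbb Z^{\mathbb N}$ is given by $s_j(\gamma)=n$ if $\gamma(j)\in I_n$, and $s_j(\gamma)=m$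 if $\gamma(j)$ is one of the points $p_l$ and $\gamma(j+\frac12)\in I_m$. Let $\overline\Omega_\infty$ be the quotient of $\Omega_\infty$ by the relation $s(\gamma_1)=s(\gamma_2)$, and $\overline T_1$ the map of $\overline\Omega_\infty$ induced by $\gamma\mapsto\gamma(\cdot+1)$. Let $\mathcal G$ be the directed graph whose vertices are the arcs occurring in itineraries of trajectories in $\Omega_\infty$ and whose edges are the transitions $s_j(\gamma)\to s_{j+1}(\gamma)$. For $\widetilde\Omega\subseteq\overline\Omega_\infty$ let $\mathcal H_{\widetilde\Omega}$ be the subgraph of $\mathcal G$ induced on the arcs that occur in trajectories of $\widetilde\Omega$. The Gurevich entropy $h_G(Z_\infty|_{\widetilde\Omega})$ is that of the one-sided topological Markov shift of $\mathcal H_{\widetilde\Omega}$, i.e. the supremum of the topological entropies of the Markov shifts of the finite subgraphs of $\mathcal H_{\widetilde\Omega}$. The Gurevich pressure of the zero potential at a vertex $a$ is $P_G(0,[a])=\limsup_{n\to\infty}\frac1n\log\#\{x:\sigma^n x=x,\ x_0=a\}$, where $x$ runs over the same Markov shift. Then for every $\widetilde\Omega\subseteq\overline\Omega_\infty$ $$h_G\left(Z_\infty|_{\widetilde\Omega}\right)<\infty,\qquad\text{and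 } P_G(0,[a])<\infty\text{ for every vertex } a \text{ of } \mathcal H_{\widetilde\Omega}.$$ Moreover there is a nonempty $\widetilde\Omega\subseteq\overline\Omega_\infty$ with $\overline T_1(\widetilde\Omega)\subseteq\widetilde\Omega$ whose Markov shift is topologically transitive (any two vertices of $\mathcal H_{\widetilde\Omega}$ are joined by a path of positive length) and for which $h_G(Z_\infty|_{\widetilde\Omega})<\infty$. -/

import Mathlib

open Set Filter Topology
open scoped NNReal ENNReal ContDiff

noncomputable section

/-! ### Planar piecewise smooth vector fields and their trajectories -/

/-- A planar piecewise smooth vector field: `Xp` acts on `{0 ≤ f}`, `Xm` on `{f ≤ 0}`, and the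
switching manifold is `{f = 0}`. -/
structure PSVF where
  f : ℝ × ℝ → ℝ
  Xp : ℝ × ℝ → ℝ × ℝ
  Xm : ℝ × ℝ → ℝ × ℝ
  contDiff_f : ContDiff ℝ ∞ f
  regular_value : ∀ q, f q = 0 → fderiv ℝ f q ≠ 0
  contDiff_Xp : ContDiff ℝ 1 Xp
  contDiff_Xm : ContDiff ℝ 1 Xm

namespace PSVF

/-- The Lie derivative `X f (q) = ⟨∇ f (q), X (q)⟩`. -/
def lieDeriv (f : ℝ × ℝ → ℝ) (X : ℝ × ℝ → ℝ × ℝ) (q : ℝ × ℝ) : ℝ :=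
  fderiv ℝ f q (X q)

/-- The orbit of `X` through `q` is tangent to `{f = 0}` at `q` and stays in `{0 ≤ f}` before and
after `q`. -/
def VisibleAt (f : ℝ × ℝ → ℝ) (X : ℝ × ℝ → ℝ × ℝ) (q : ℝ × ℝ) : Prop :=
  lieDeriv f X q = 0 ∧ ∃ δ > 0, ∃ c : ℝ → ℝ × ℝ, c 0 = q ∧
    IsIntegralCurveOn c (fun _ ↦ X) (Ioo (-δ) δ) ∧ ∀ t ∈ Ioo (-δ) δ, 0 ≤ f (c t)

/-- Tangential singularities: points of the switching manifold with `X⁺f · X⁻f = 0` which are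
equilibria neither of `X⁺` nor of `X⁻`. -/
def IsTangency (Z : PSVF) (q : ℝ × ℝ) : Prop :=
  Z.f q = 0 ∧ lieDeriv Z.f Z.Xp q * lieDeriv Z.f Z.Xm q = 0 ∧ Z.Xp q ≠ 0 ∧ Z.Xm q ≠ 0

/-- A tangency is singular if it is an invisible tangency for both fields. -/
def IsSingularTangency (Z : PSVF) (q : ℝ × ℝ) : Prop :=
  Z.IsTangency q ∧ lieDeriv Z.f Z.Xp q = 0 ∧ lieDeriv Z.f Z.Xm q = 0 ∧
    ¬ VisibleAt Z.f Z.Xp q ∧ ¬ VisibleAt (fun p ↦ -Z.f p) Z.Xm q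

def IsRegularTangency (Z : PSVF) (q : ℝ × ℝ) : Prop :=
  Z.IsTangency q ∧ ¬ Z.IsSingularTangency q

/-- Just before time `t` (and at nonnegative times only) the curve `c` is an orbit of `X`. -/
def FollowsBefore (X : ℝ × ℝ → ℝ × ℝ) (c : ℝ → ℝ × ℝ) (t : ℝ) : Prop :=
  ∃ ε > 0, IsIntegralCurveOn c (fun _ ↦ X) (Ioc (t - ε) t ∩ Ici 0)

/-- Just after time `t` the curve `c` is an orbit of `X`. -/
def FollowsAfter (X : ℝ × ℝ → ℝ × ℝ) (c : ℝ → ℝ × ℝ) (t : ℝ) : Prop :=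
  ∃ ε > 0, IsIntegralCurveOn c (fun _ ↦ X) (Ico t (t + ε))

/-- Near time `t`, within `[0, ∞)`, the curve `c` is a local trajectory of `Z` through `c t`.
There is no local trajectory through a point where the fields slide or through an equilibrium on
the switching manifold. -/
inductive IsLocalTrajectoryAt (Z : PSVF) (c : ℝ → ℝ × ℝ) (t : ℝ) : Prop
  | upper (h : 0 < Z.f (c t)) (hb : FollowsBefore Z.Xp c t) (ha : FollowsAfter Z.Xp c t)
  | lower (h : Z.f (c t) < 0) (hb : FollowsBefore Z.Xm c t) (ha : FollowsAfter Z.Xm c t)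
  | crossingUp (h : Z.f (c t) = 0)
      (hp : 0 < lieDeriv Z.f Z.Xp (c t)) (hm : 0 < lieDeriv Z.f Z.Xm (c t))
      (hb : FollowsBefore Z.Xm c t) (ha : FollowsAfter Z.Xp c t)
  | crossingDown (h : Z.f (c t) = 0)
      (hp : lieDeriv Z.f Z.Xp (c t) < 0) (hm : lieDeriv Z.f Z.Xm (c t) < 0)
      (hb : FollowsBefore Z.Xp c t) (ha : FollowsAfter Z.Xm c t)
  | regularTangency (h : Z.IsRegularTangency (c t))
      (hb : FollowsBefore Z.Xp c t ∨ FollowsBefore Z.Xm c t)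
      (ha : FollowsAfter Z.Xp c t ∨ FollowsAfter Z.Xm c t)
  | singularTangency (h : Z.IsSingularTangency (c t))
      (hc : ∃ ε > 0, ∀ τ ∈ Ioo (t - ε) (t + ε) ∩ Ici 0, c τ = c t)

/-- The curve `[0, ∞) → ℝ²` as a function of a real time (constant for negative times, which play
no role). -/
def curve (γ : ℝ≥0 → ℝ × ℝ) (t : ℝ) : ℝ × ℝ := γ t.toNNReal

/-- A positive global trajectory: a curve on `[0, ∞)` that is a concatenation of local
trajectories. -/
def IsPositiveGlobalTrajectory (Z : PSVF) (γ : ℝ≥0 → ℝ × ℝ) : Prop :=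
  ∀ t : ℝ, 0 ≤ t → Z.IsLocalTrajectoryAt (curve γ) t

lemma curve_shift (γ : ℝ≥0 → ℝ × ℝ) {t : ℝ} (ht : 0 ≤ t) :
    curve (fun u ↦ γ (u + 1)) t = curve γ (t + 1) := by
  simp [curve, Real.toNNReal_add ht zero_le_one]

lemma isIntegralCurveOn_shift {X : ℝ × ℝ → ℝ × ℝ} {γ : ℝ≥0 → ℝ × ℝ} {s s' : Set ℝ}
    (h : IsIntegralCurveOn (curve γ) (fun _ ↦ X) s) (hs : ∀ τ ∈ s', 0 ≤ τ ∧ τ + 1 ∈ s) :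
    IsIntegralCurveOn (curve fun u ↦ γ (u + 1)) (fun _ ↦ X) s' := by
  intro τ hτ
  have h1 : HasDerivWithinAt (fun x ↦ curve γ (x + 1)) (X (curve γ (τ + 1))) s' τ := by
    have := (h (τ + 1) (hs τ hτ).2).scomp τ
      (((hasDerivAt_id τ).add_const 1).hasDerivWithinAt (s := s')) (fun x hx ↦ (hs x hx).2)
    simpa [Function.comp_def] using this
  have := h1.congr (fun x hx ↦ curve_shift γ (hs x hx).1) (curve_shift γ (hs τ hτ).1)
  simpa [curve_shift γ (hs τ hτ).1] using this

lemma IsPositiveGlobalTrajectory.shift {Z : PSVF} {γ : ℝ≥0 → ℝ × ℝ}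
    (h : Z.IsPositiveGlobalTrajectory γ) :
    Z.IsPositiveGlobalTrajectory fun u ↦ γ (u + 1) := by
  intro t ht
  have e := curve_shift γ ht
  have hB : ∀ X, FollowsBefore X (curve γ) (t + 1) →
      FollowsBefore X (curve fun u ↦ γ (u + 1)) t := by
    rintro X ⟨ε, hε, hc⟩
    refine ⟨ε, hε, isIntegralCurveOn_shift hc ?_⟩
    rintro τ ⟨⟨h1, h2⟩, h3⟩
    simp only [mem_Ici] at h3
    exact ⟨h3, ⟨by linarith, by linarith⟩, by simp only [mem_Ici]; linarith⟩
  have hA : ∀ X, FollowsAfter X (curve γ) (t + 1) →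
      FollowsAfter X (curve fun u ↦ γ (u + 1)) t := by
    rintro X ⟨ε, hε, hc⟩
    refine ⟨ε, hε, isIntegralCurveOn_shift hc ?_⟩
    rintro τ ⟨h1, h2⟩
    exact ⟨by linarith, by linarith, by linarith⟩
  cases h (t + 1) (by linarith) with
  | upper h hb ha => exact .upper (e ▸ h) (hB _ hb) (hA _ ha)
  | lower h hb ha => exact .lower (e ▸ h) (hB _ hb) (hA _ ha)
  | crossingUp h hp hm hb ha => exact .crossingUp (e ▸ h) (e ▸ hp) (e ▸ hm) (hB _ hb) (hA _ ha)
  | crossingDown h hp hm hb ha =>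
    exact .crossingDown (e ▸ h) (e ▸ hp) (e ▸ hm) (hB _ hb) (hA _ ha)
  | regularTangency h hb ha =>
    exact .regularTangency (e ▸ h) (hb.imp (hB _) (hB _)) (ha.imp (hA _) (hA _))
  | singularTangency h hc =>
    obtain ⟨ε, hε, hc⟩ := hc
    refine .singularTangency (e ▸ h) ⟨ε, hε, ?_⟩
    rintro τ ⟨⟨h1, h2⟩, h3⟩
    simp only [mem_Ici] at h3
    rw [curve_shift γ h3, e]
    exact hc _ ⟨⟨by linarith, by linarith⟩, by simp only [mem_Ici]; linarith⟩

end PSVF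

/-! ### The field `Z∞`, its trajectories in `Λ∞`, and their itineraries -/

namespace ZInf

/-- `Z∞ = (X⁺, X⁻)` with `X⁺ = (1, 2 sin (2πx))` for `y ≥ 0` and `X⁻ = (-1, 2 sin (2πx))` for
`y ≤ 0`. -/
def field : PSVF where
  f q := q.2
  Xp q := (1, 2 * Real.sin (2 * Real.pi * q.1))
  Xm q := (-1, 2 * Real.sin (2 * Real.pi * q.1))
  contDiff_f := contDiff_snd
  regular_value q _ h := by
    have h1 : fderiv ℝ (fun q : ℝ × ℝ ↦ q.2) q = ContinuousLinearMap.snd ℝ ℝ ℝ := fderiv_snd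
    have h2 := congrArg (fun L : ℝ × ℝ →L[ℝ] ℝ ↦ L (0, 1)) (h1.symm.trans h)
    simp at h2
  contDiff_Xp := by fun_prop
  contDiff_Xm := by fun_prop

/-- The graph of `P` is the orbit of `X⁺`, and the graph of `-P` the orbit of `X⁻`, through the
points `(j, 0)`. -/
def P (x : ℝ) : ℝ := (1 - Real.cos (2 * Real.pi * x)) / Real.pi

/-- `Λ∞`, the union of the graphs of `P` and `-P`. -/
def Lam : Set (ℝ × ℝ) := {q | q.2 = P q.1 ∨ q.2 = -P q.1}

/-- The visible-visible two-folds `p_j = (j, 0)`. -/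
def folds : Set (ℝ × ℝ) := {q | ∃ j : ℤ, q = ((j : ℝ), 0)}

/-- The open arcs: `I_{2j}` is the graph of `P` and `I_{2j+1}` the graph of `-P`, over
`(j, j + 1)`. -/
def arc (n : ℤ) : Set (ℝ × ℝ) :=
  {q | ((n / 2 : ℤ) : ℝ) < q.1 ∧ q.1 < ((n / 2 : ℤ) : ℝ) + 1 ∧
    q.2 = if Even n then P q.1 else -P q.1}

/-- `Ω∞`, the positive global trajectories of `Z∞` starting in `Λ∞`. -/
def Omega : Set (ℝ≥0 → ℝ × ℝ) :=
  {γ | field.IsPositiveGlobalTrajectory γ ∧ γ 0 ∈ Lam}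

lemma hasDerivAt_P (x : ℝ) : HasDerivAt P (2 * Real.sin (2 * Real.pi * x)) x := by
  have h1 : HasDerivAt (fun x : ℝ ↦ 2 * Real.pi * x) (2 * Real.pi) x := by
    simpa using (hasDerivAt_id x).const_mul (2 * Real.pi)
  have h2 := ((h1.cos).const_sub 1).div_const Real.pi
  refine h2.congr_deriv ?_
  have := Real.pi_ne_zero
  field_simp

lemma continuous_P : Continuous P := by
  unfold P; fun_prop

lemma isClosed_Lam : IsClosed Lam :=
  (isClosed_eq continuous_snd (continuous_P.comp continuous_fst)).union
    (isClosed_eq continuous_snd (continuous_P.comp continuous_fst).neg)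

/-- If `c` follows `(a, 2 sin (2πx))` with `a² = 1`, then `y - a P(x)` is conserved. -/
lemma conserved {a : ℝ} (ha : a * a = 1) {c : ℝ → ℝ × ℝ} {t ε : ℝ}
    (h : IsIntegralCurveOn c (fun _ q ↦ (a, 2 * Real.sin (2 * Real.pi * q.1))) (Ico t (t + ε)))
    {τ : ℝ} (hτ : τ ∈ Ico t (t + ε)) :
    (c τ).2 - a * P (c τ).1 = (c t).2 - a * P (c t).1 := by
  have hd : ∀ x ∈ Ico t (t + ε),
      HasDerivWithinAt (fun s ↦ (c s).2 - a * P (c s).1) 0 (Ico t (t + ε)) x := by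
    intro x hx
    have h1 : HasDerivWithinAt (fun s ↦ (c s).1) a (Ico t (t + ε)) x := (h x hx).fst
    have h2 : HasDerivWithinAt (fun s ↦ (c s).2) (2 * Real.sin (2 * Real.pi * (c x).1))
        (Ico t (t + ε)) x := (h x hx).snd
    have h3 := h2.sub (((hasDerivAt_P (c x).1).comp_hasDerivWithinAt x h1).const_mul a)
    refine h3.congr_deriv ?_
    linear_combination (-2 * Real.sin (2 * Real.pi * (c x).1)) * ha
  have := (convex_Ico t (t + ε)).norm_image_sub_le_of_norm_hasDerivWithin_le (C := 0) hd
    (by simp) ⟨le_rfl, hτ.1.trans_lt hτ.2⟩ hτ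
  simpa [sub_eq_zero] using this

lemma continuousWithinAt_of_local {c : ℝ → ℝ × ℝ} {t : ℝ} (ht : 0 ≤ t)
    (h : field.IsLocalTrajectoryAt c t) : ContinuousWithinAt c (Ici 0) t := by
  have key : ∀ X Y, PSVF.FollowsBefore X c t → PSVF.FollowsAfter Y c t →
      ContinuousWithinAt c (Ici 0) t := by
    rintro X Y ⟨ε, hε, h1⟩ ⟨δ, hδ, h2⟩
    have c1 := h1.continuousWithinAt ⟨⟨by linarith, le_rfl⟩, ht⟩
    have c2 := h2.continuousWithinAt ⟨le_rfl, by linarith⟩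
    refine (c1.union c2).mono_of_mem_nhdsWithin ?_
    filter_upwards [self_mem_nhdsWithin,
      mem_nhdsWithin_of_mem_nhds (Ioo_mem_nhds (by linarith : t - ε < t)
        (by linarith : t < t + δ))] with x hx hx'
    rcases le_total x t with hxt | hxt
    · exact Or.inl ⟨⟨hx'.1, hxt⟩, hx⟩
    · exact Or.inr ⟨hxt, hx'.2⟩
  cases h with
  | upper h hb ha => exact key _ _ hb ha
  | lower h hb ha => exact key _ _ hb ha
  | crossingUp h hp hm hb ha => exact key _ _ hb ha
  | crossingDown h hp hm hb ha => exact key _ _ hb ha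
  | regularTangency h hb ha =>
    rcases hb with hb | hb <;> rcases ha with ha | ha <;> exact key _ _ hb ha
  | singularTangency h hc =>
    obtain ⟨ε, hε, hc⟩ := hc
    refine (continuousWithinAt_const (b := c t)).congr_of_eventuallyEq ?_ rfl
    filter_upwards [self_mem_nhdsWithin,
      mem_nhdsWithin_of_mem_nhds (Ioo_mem_nhds (by linarith : t - ε < t)
        (by linarith : t < t + ε))] with x hx hx'
    exact hc x ⟨hx', hx⟩

lemma P_nonneg (x : ℝ) : 0 ≤ P x :=
  div_nonneg (by linarith [Real.cos_le_one (2 * Real.pi * x)]) Real.pi_pos.le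

lemma Lam_forward {c : ℝ → ℝ × ℝ} {t : ℝ} (ht : 0 ≤ t)
    (h : field.IsLocalTrajectoryAt c t) (hL : c t ∈ Lam) : ∃ ε > 0, ∀ τ ∈ Ico t (t + ε), c τ ∈ Lam := by
  have hp : (c t).2 = P (c t).1 → PSVF.FollowsAfter field.Xp c t →
      ∃ ε > 0, ∀ τ ∈ Ico t (t + ε), c τ ∈ Lam := by
    rintro h0 ⟨ε, hε, hc⟩
    refine ⟨ε, hε, fun τ hτ ↦ Or.inl ?_⟩
    have := conserved (a := 1) (by norm_num) hc hτ
    linarith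
  have hm : (c t).2 = -P (c t).1 → PSVF.FollowsAfter field.Xm c t →
      ∃ ε > 0, ∀ τ ∈ Ico t (t + ε), c τ ∈ Lam := by
    rintro h0 ⟨ε, hε, hc⟩
    refine ⟨ε, hε, fun τ hτ ↦ Or.inr ?_⟩
    have := conserved (a := -1) (by norm_num) hc hτ
    linarith
  have hP := P_nonneg (c t).1
  have hz : (c t).2 = 0 → (c t).2 = P (c t).1 ∧ (c t).2 = -P (c t).1 := by
    intro h0
    rcases hL with h | h <;> constructor <;> linarith
  cases h with
  | upper h hb ha =>
    have h' : 0 < (c t).2 := h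
    refine hp ?_ ha
    rcases hL with h | h
    · exact h
    · linarith
  | lower h hb ha =>
    have h' : (c t).2 < 0 := h
    refine hm ?_ ha
    rcases hL with h | h
    · linarith
    · exact h
  | crossingUp h _ _ hb ha => exact hp (hz h).1 ha
  | crossingDown h _ _ hb ha => exact hm (hz h).2 ha
  | regularTangency h hb ha =>
    rcases ha with ha | ha
    · exact hp (hz h.1.1).1 ha
    · exact hm (hz h.1.1).2 ha
  | singularTangency h hc =>
    obtain ⟨ε, hε, hc⟩ := hc
    refine ⟨ε, hε, fun τ hτ ↦ ?_⟩
    rw [hc τ ⟨⟨by linarith [hτ.1], hτ.2⟩, ht.trans hτ.1⟩]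
    exact hL

/-- `Λ∞` is invariant. -/
lemma mem_Lam {γ : ℝ≥0 → ℝ × ℝ} (hγ : γ ∈ Omega) (t : ℝ≥0) : γ t ∈ Lam := by
  obtain ⟨h, h0⟩ := hγ
  have hcont : ContinuousOn (PSVF.curve γ) (Icc 0 (t : ℝ)) := fun x hx ↦
    (continuousWithinAt_of_local hx.1 (h x hx.1)).mono fun y hy ↦ hy.1
  have hcl : IsClosed (PSVF.curve γ ⁻¹' Lam ∩ Icc 0 (t : ℝ)) := by
    rw [inter_comm]
    exact hcont.preimage_isClosed_of_isClosed isClosed_Icc isClosed_Lam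
  have hsub := hcl.Icc_subset_of_forall_mem_nhdsWithin
    (by simpa [PSVF.curve] using h0) (by
      rintro x ⟨hx, hx1, hx2⟩
      obtain ⟨ε, hε, hc⟩ := Lam_forward hx1 (h x hx1) hx
      exact mem_of_superset (Ioo_mem_nhdsGT (by linarith : x < x + ε))
        fun y hy ↦ hc y ⟨hy.1.le, hy.2⟩)
  simpa [PSVF.curve] using hsub ⟨t.2, le_rfl⟩

/-- The time-one map `T₁ γ = γ (· + 1)` on `Ω∞`. -/
def timeOne (γ : Omega) : Omega :=
  ⟨fun t ↦ γ.1 (t + 1), γ.2.1.shift, mem_Lam γ.2 (0 + 1)⟩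

open Classical in
/-- The symbol determined by the positions `p` and `q` at two times half a unit apart: `n` if
`p ∈ I_n`, and `m` if `p` is one of the points `p_l` and `q ∈ I_m`. -/
def symbol (p q : ℝ × ℝ) : ℤ :=
  if h : ∃ n, p ∈ arc n then h.choose
  else if h : p ∈ folds ∧ ∃ m, q ∈ arc m then h.2.choose
  else 0

/-- The itinerary `s(γ)`: `s_j(γ)` is `n` if `γ(j) ∈ I_n`, and is `m` if `γ(j)` is one of the
points `p_l` and `γ(j + 1/2) ∈ I_m`. The arcs are pairwise disjoint, and one of the two cases
occurs for every trajectory in `Ω∞`. -/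
def itinerary (γ : Omega) (j : ℕ) : ℤ := symbol (γ.1 j) (γ.1 (j + 1 / 2))

/-- Two trajectories are equivalent if they have the same itinerary. -/
def sameItinerary : Setoid Omega := Setoid.ker itinerary

/-- The quotient `Ω̄∞ = Ω∞ / ∼`. -/
def OmegaBar : Type := Quotient sameItinerary

lemma itinerary_timeOne (γ : Omega) (j : ℕ) :
    itinerary (timeOne γ) j = itinerary γ (j + 1) := by
  have e : (j : ℝ≥0) + 1 / 2 + 1 = (j + 1 : ℕ) + 1 / 2 := by push_cast; ring
  simp only [itinerary, timeOne, e]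
  simp

/-- The map `T̄₁` induced by `T₁` on the quotient. -/
def timeOneBar : OmegaBar → OmegaBar :=
  Quotient.map timeOne fun γ₁ γ₂ h ↦ funext fun j ↦ by
    rw [itinerary_timeOne, itinerary_timeOne]
    exact congrFun h (j + 1)

/-- The map `s̄` induced by `s` on the quotient. -/
def itineraryBar : OmegaBar → ℕ → ℤ :=
  Quotient.lift itinerary fun _ _ h ↦ h

end ZInf

/-! ### Directed graphs, topological Markov shifts, Gurevich entropy and pressure -/

/-- A directed graph with vertex set `verts` and edge relation `Adj`. -/
structure DirectedGraph (V : Type*) where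
  verts : Set V
  Adj : V → V → Prop
  left_mem : ∀ {a b}, Adj a b → a ∈ verts
  right_mem : ∀ {a b}, Adj a b → b ∈ verts

namespace DirectedGraph

variable {V : Type*}

def IsSubgraph (H G : DirectedGraph V) : Prop :=
  H.verts ⊆ G.verts ∧ ∀ a b, H.Adj a b → G.Adj a b

/-- The subgraph of `G` induced on the vertices that lie in `S`. -/
def induce (G : DirectedGraph V) (S : Set V) : DirectedGraph V where
  verts := G.verts ∩ S
  Adj a b := G.Adj a b ∧ a ∈ S ∧ b ∈ S
  left_mem h := ⟨G.left_mem h.1, h.2.1⟩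
  right_mem h := ⟨G.right_mem h.1, h.2.2⟩

/-- The one-sided topological Markov shift associated with `G`. -/
def markovShift (G : DirectedGraph V) : Set (ℕ → V) :=
  {x | ∀ i, G.Adj (x i) (x (i + 1))}

/-- The left shift. -/
def shiftMap (x : ℕ → V) : ℕ → V := fun i ↦ x (i + 1)

/-- Any two vertices are joined by a path of positive length. -/
def IsTransitive (G : DirectedGraph V) : Prop :=
  ∀ a ∈ G.verts, ∀ b ∈ G.verts, Relation.TransGen G.Adj a b

/-- The Gurevich entropy of the Markov shift of `G`: the supremum over the finite subgraphs `H` of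
the topological entropies of the (compact) Markov shifts of `H`, where `ℕ → V` carries the product
of the discrete uniformities. The empty shift has topological entropy `⊥`. -/
def gurevichEntropy [UniformSpace V] [DiscreteUniformity V] (G : DirectedGraph V) : EReal :=
  ⨆ (H : DirectedGraph V) (_ : H.IsSubgraph G ∧ H.verts.Finite),
    Dynamics.coverEntropy shiftMap H.markovShift

/-- The `n`-th partition function of the potential `ψ` at the vertex `a`: the sum of
`exp (ψ(x) + ψ(σ x) + ⋯ + ψ(σⁿ⁻¹ x))` over the points `x` of the Markov shift with `σⁿ x = x` and
`x 0 = a`. -/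
def partitionFunction (G : DirectedGraph V) (ψ : (ℕ → V) → ℝ) (a : V) (n : ℕ) : ℝ≥0∞ :=
  ∑' x : {x : ℕ → V // x ∈ G.markovShift ∧ shiftMap^[n] x = x ∧ x 0 = a},
    ENNReal.ofReal (Real.exp (∑ k ∈ Finset.range n, ψ (shiftMap^[k] x.1)))

/-- The Gurevich pressure of the potential `ψ` at the vertex `a`. -/
def gurevichPressure (G : DirectedGraph V) (ψ : (ℕ → V) → ℝ) (a : V) : EReal :=
  limsup (fun n : ℕ ↦ ENNReal.log (G.partitionFunction ψ a n) / (n : EReal)) atTop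

end DirectedGraph

namespace ZInf

/-- The graph of `Z∞`: the vertices are (the indices of) the arcs that occur in trajectories of
`Ω∞`, and the edges are the transitions from one arc to the next. -/
def transitionGraph : DirectedGraph ℤ where
  verts := {n | ∃ γ : Omega, ∃ j, itinerary γ j = n}
  Adj a b := ∃ γ : Omega, ∃ j, itinerary γ j = a ∧ itinerary γ (j + 1) = b
  left_mem := fun ⟨γ, j, h, _⟩ ↦ ⟨γ, j, h⟩
  right_mem := fun ⟨γ, j, _, h⟩ ↦ ⟨γ, j + 1, h⟩

/-- The subgraph of the arcs that occur in the trajectories of `W ⊆ Ω̄∞`. -/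
def subgraph (W : Set OmegaBar) : DirectedGraph ℤ :=
  transitionGraph.induce {n | ∃ c ∈ W, ∃ j, itineraryBar c j = n}

/-- The Gurevich entropy `h_G(Z∞|W)` of `Z∞` on `W ⊆ Ω̄∞`. -/
def entropy (W : Set OmegaBar) : EReal := (subgraph W).gurevichEntropy

end ZInf

end

/-! Both fields have horizontal velocity `1` or `-1`, so the first coordinate of a trajectory is
`1`-Lipschitz in time, and a symbol of an itinerary locates the trajectory up to a bounded error.
Although there are infinitely many arcs, consecutive symbols differ by at most `5`
(`itinerary_succ_sub_mem`).

Labelling the edge from `a` to `b` by `b - a` thus uses only the `11` labels in `[-5, 5]`, and a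
start vertex together with the labels determines a path. A path of length `n` from a given vertex is
one of at most `11 ^ n`. This bounds the entropy of every finite subgraph
(`IsLabelling.gurevichEntropy_le`) and the number of periodic points through a vertex
(`IsLabelling.partitionFunction_le`), so `log 11` bounds both the Gurevich entropy and the pressure,
whatever the subset.

For the transitive example the whole quotient works, and its invariance is trivial. At a
visible-visible fold a trajectory may continue along either field, and each arc takes exactly one
unit of time between neighbouring folds. Every nearest-neighbour walk on the integers is therefore
realised by a trajectory (`foldPath_mem_Omega`), and two-step walks already give enough edges to
connect any two arcs. -/

namespace DirectedGraph

/-! ### Entropy and pressure of graphs with boundedly many edge labels -/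

variable {V L : Type*}

/-- The labels `ℓ` of the edges of `G` lie in `S`, and edges leaving the same vertex have different
labels. -/
structure IsLabelling (G : DirectedGraph V) (ℓ : V → V → L) (S : Finset L) : Prop where
  mem : ∀ {a b}, G.Adj a b → ℓ a b ∈ S
  injective : ∀ {a b c}, G.Adj a b → G.Adj a c → ℓ a b = ℓ a c → b = c

namespace IsLabelling

variable {G H : DirectedGraph V} {ℓ : V → V → L} {S : Finset L}

lemma mono (h : G.IsLabelling ℓ S) (hHG : H.IsSubgraph G) : H.IsLabelling ℓ S where
  mem hab := h.mem (hHG.2 _ _ hab)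
  injective hab hac := h.injective (hHG.2 _ _ hab) (hHG.2 _ _ hac)

/-- The labels of the first `n` edges of a point of the Markov shift. -/
def word (h : G.IsLabelling ℓ S) (n : ℕ) (x : G.markovShift) (i : Fin n) : S :=
  ⟨ℓ (x.1 i) (x.1 (i + 1)), h.mem (x.2 i)⟩

/-- The vertices are recovered one at a time: the current vertex and the label of the next edge
determine the next vertex. -/
lemma eq_of_word_eq (h : G.IsLabelling ℓ S) {n : ℕ} {x y : G.markovShift}
    (h0 : x.1 0 = y.1 0) (hw : h.word n x = h.word n y) : ∀ i ≤ n, x.1 i = y.1 i := by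
  intro i
  induction i with
  | zero => exact fun _ ↦ h0
  | succ i ih =>
    intro hi
    have hxy := ih (by omega)
    have hl : ℓ (x.1 i) (x.1 (i + 1)) = ℓ (y.1 i) (y.1 (i + 1)) :=
      congrArg Subtype.val (congrFun hw ⟨i, hi⟩)
    refine h.injective (x.2 i) ?_ (hl.trans (by rw [hxy]))
    rw [hxy]
    exact y.2 i

end IsLabelling

lemma shiftMap_iterate (n : ℕ) (x : ℕ → V) (i : ℕ) : shiftMap^[n] x i = x (n + i) := by
  induction n generalizing x with
  | zero => simp
  | succ n ih =>
    rw [Function.iterate_succ_apply, ih]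
    exact congrArg x (by omega)

/-- Picking one point in each nonempty fibre of `Φ` gives a dynamical cover. -/
lemma _root_.Dynamics.coverMincard_le_card_of_map {X β : Type*} [Fintype β] {T : X → X} {F : Set X}
    {U : SetRel X X} {n : ℕ} (Φ : F → β)
    (hΦ : ∀ x y : F, Φ x = Φ y → ∀ k < n, (T^[k] x.1, T^[k] y.1) ∈ U) :
    Dynamics.coverMincard T F U n ≤ Fintype.card β := by
  classical
  let s : Finset X := (Finset.univ.image fun b : range Φ ↦ (b.2.choose : X))
  have hs : Dynamics.IsDynCoverOf T F U n s := by
    intro x hx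
    let b : range Φ := ⟨Φ ⟨x, hx⟩, mem_range_self _⟩
    refine ⟨b.2.choose, Finset.mem_coe.2 (Finset.mem_image_of_mem _ (Finset.mem_univ b)), ?_⟩
    exact Dynamics.mem_dynEntourage.2 (hΦ ⟨x, hx⟩ _ b.2.choose_spec.symm)
  refine hs.coverMincard_le_card.trans ?_
  have : s.card ≤ Fintype.card β :=
    Finset.card_image_le.trans ((Fintype.card_subtype_le _))
  exact_mod_cast this

/-- An entourage of the product of discrete uniformities constrains only finitely many coordinates;
`m` bounds their indices. -/
lemma exists_forall_le_imp_mem_uniformity [UniformSpace V] [DiscreteUniformity V]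
    {U : SetRel (ℕ → V) (ℕ → V)} (hU : U ∈ uniformity (ℕ → V)) :
    ∃ m, ∀ x y : ℕ → V, (∀ i ≤ m, x i = y i) → (x, y) ∈ U := by
  rw [Pi.uniformity] at hU
  obtain ⟨I, hI, v, hv, rfl⟩ := mem_iInf.1 hU
  obtain ⟨m, hm⟩ := hI.bddAbove
  refine ⟨m, fun x y hxy ↦ mem_iInter.2 fun i ↦ ?_⟩
  obtain ⟨t, ht, htv⟩ := mem_comap.1 (hv i)
  apply htv
  rw [DiscreteUniformity.eq_principal_setRelId, mem_principal] at ht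
  exact ht (hxy i (hm i.2))

/-- At the scale of an entourage that sees the coordinates up to `m`, an orbit segment of length `n`
is coded by its start vertex and `m + n` labels. The factor `|V| * |S| ^ m` does not depend on `n`,
so only `|S| ^ n` contributes to the growth rate. -/
lemma IsLabelling.coverEntropy_le [UniformSpace V] [DiscreteUniformity V] {G : DirectedGraph V}
    {ℓ : V → V → L} {S : Finset L} (h : G.IsLabelling ℓ S) (hG : G.verts.Finite) :
    Dynamics.coverEntropy shiftMap G.markovShift ≤ ENNReal.log S.card := by
  classical
  refine iSup₂_le fun U hU ↦ ?_
  obtain ⟨m, hm⟩ := exists_forall_le_imp_mem_uniformity hU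
  have := hG.fintype
  rcases G.markovShift.eq_empty_or_nonempty with he | ⟨x₀, hx₀⟩
  · simp [he]
  have hS : S.card ≠ 0 := Finset.card_ne_zero_of_mem (h.mem (hx₀ 0))
  have hV : Fintype.card G.verts ≠ 0 :=
    (Fintype.card_pos_iff.2 ⟨⟨x₀ 0, G.left_mem (hx₀ 0)⟩⟩).ne'
  have hcard : ∀ n, Dynamics.coverMincard shiftMap G.markovShift U n ≤
      (Fintype.card G.verts * S.card ^ m * S.card ^ n : ℕ) := by
    intro n
    -- Comparing coordinates `i ≤ m` at times `k < n` involves only indices `k + i < m + n`.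
    refine (Dynamics.coverMincard_le_card_of_map (β := G.verts × (Fin (m + n) → S))
      (fun x : G.markovShift ↦ (⟨x.1 0, G.left_mem (x.2 0)⟩, h.word (m + n) x)) ?_).trans (by
        simp [pow_add, mul_assoc])
    intro x y hxy k hk
    obtain ⟨h0, hw⟩ := Prod.ext_iff.1 hxy
    refine hm _ _ fun i hi ↦ ?_
    rw [shiftMap_iterate, shiftMap_iterate]
    exact h.eq_of_word_eq (congrArg Subtype.val h0) hw _ (by omega)
  have hgrowth : ExpGrowth.expGrowthSup
      ((fun _ ↦ ((Fintype.card G.verts * S.card ^ m : ℕ) : ℝ≥0∞)) *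
        fun n ↦ (S.card : ℝ≥0∞) ^ n) ≤ ENNReal.log S.card := by
    have hc : ExpGrowth.expGrowthSup
        (fun _ ↦ ((Fintype.card G.verts * S.card ^ m : ℕ) : ℝ≥0∞)) = 0 :=
      ExpGrowth.expGrowthSup_const
        (Nat.cast_ne_zero.2 (mul_ne_zero hV (pow_ne_zero _ hS))) (ENNReal.natCast_ne_top _)
    refine (ExpGrowth.expGrowthSup_mul_le (.inl (by rw [hc]; exact EReal.zero_ne_bot))
      (.inl (by rw [hc]; exact EReal.zero_ne_top))).trans ?_
    rw [hc, zero_add, ExpGrowth.expGrowthSup_pow]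
  refine le_trans (ExpGrowth.expGrowthSup_monotone fun n ↦ ?_) hgrowth
  have := ENat.toENNReal_mono (hcard n)
  rw [ENat.toENNReal_coe] at this
  simpa only [Nat.cast_mul, Nat.cast_pow, Pi.mul_apply] using this

/-- A graph with an edge labelling by a finite set `S`, injective on the edges leaving each vertex,
has Gurevich entropy at most `log |S|`. -/
lemma IsLabelling.gurevichEntropy_le [UniformSpace V] [DiscreteUniformity V] {G : DirectedGraph V}
    {ℓ : V → V → L} {S : Finset L} (h : G.IsLabelling ℓ S) :
    G.gurevichEntropy ≤ ENNReal.log S.card :=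
  iSup₂_le fun _ hH ↦ (h.mono hH.1).coverEntropy_le hH.2

/-- A point of period `n` starting at `a` is determined by its first `n` labels. For `n = 0`
periodicity is no restriction, and there may be infinitely many points. -/
lemma IsLabelling.partitionFunction_le {G : DirectedGraph V} {ℓ : V → V → L} {S : Finset L}
    (h : G.IsLabelling ℓ S) (a : V) {n : ℕ} (hn : n ≠ 0) :
    G.partitionFunction (fun _ ↦ 0) a n ≤ (S.card : ℝ≥0∞) ^ n := by
  classical
  let A := {x : ℕ → V // x ∈ G.markovShift ∧ shiftMap^[n] x = x ∧ x 0 = a}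
  let Φ : A → (Fin n → S) := fun x ↦ h.word n ⟨x.1, x.2.1⟩
  have hΦ : Function.Injective Φ := by
    intro x y hxy
    have hle := h.eq_of_word_eq (x := ⟨x.1, x.2.1⟩) (y := ⟨y.1, y.2.1⟩)
      (x.2.2.2.trans y.2.2.2.symm) hxy
    refine Subtype.ext (funext fun i ↦ ?_)
    -- The labels settle the indices below `n`; periodicity reduces any other index by `n`.
    induction i using Nat.strong_induction_on with
    | _ i ih =>
      rcases lt_or_ge i n with hi | hi
      · exact hle i hi.le
      · obtain ⟨k, rfl⟩ := Nat.exists_eq_add_of_le hi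
        rw [← shiftMap_iterate n x.1, ← shiftMap_iterate n y.1, x.2.2.1, y.2.2.1]
        exact ih k (by omega)
  have : Finite A := Finite.of_injective Φ hΦ
  have := Fintype.ofFinite A
  have hc := Fintype.card_le_of_injective Φ hΦ
  change ∑' x : A, _ ≤ _
  rw [tsum_fintype]
  simp only [Fintype.card_pi, Fintype.card_coe, Finset.prod_const, Finset.card_univ,
    Fintype.card_fin] at hc
  simp only [Finset.sum_const_zero, Real.exp_zero, ENNReal.ofReal_one, Finset.sum_const,
    Finset.card_univ, nsmul_eq_mul, mul_one]
  exact_mod_cast hc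

lemma IsLabelling.gurevichPressure_zero_le {G : DirectedGraph V} {ℓ : V → V → L} {S : Finset L}
    (h : G.IsLabelling ℓ S) (a : V) :
    G.gurevichPressure (fun _ ↦ 0) a ≤ ENNReal.log S.card := by
  rw [← ExpGrowth.expGrowthSup_pow]
  refine ExpGrowth.expGrowthSup_eventually_monotone ?_
  filter_upwards [eventually_ne_atTop 0] with n hn
  exact h.partitionFunction_le a hn

end DirectedGraph

namespace ZInf

/-! ### Explicit orbits and the folds -/

open PSVF

/-- The vector field `(a, 2 sin (2πx))`; it is `X⁺` for `a = 1` and `X⁻` for `a = -1`. -/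
noncomputable def vf (a : ℝ) (q : ℝ × ℝ) : ℝ × ℝ := (a, 2 * Real.sin (2 * Real.pi * q.1))

/-- The orbit of `vf a` through `(x, a P(x))`, for `a² = 1`. -/
noncomputable def orbit (a x s : ℝ) : ℝ × ℝ := (x + a * s, a * P (x + a * s))

lemma hasDerivAt_orbit {a : ℝ} (ha : a * a = 1) (x s : ℝ) :
    HasDerivAt (orbit a x) (vf a (orbit a x s)) s := by
  have h1 : HasDerivAt (fun s ↦ x + a * s) a s := by
    simpa using ((hasDerivAt_id s).const_mul a).const_add x
  have h2 := ((hasDerivAt_P (x + a * s)).comp s h1).const_mul a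
  refine (h1.prodMk h2).congr_deriv ?_
  simp only [vf, orbit, Prod.mk.injEq, true_and]
  linear_combination (2 * Real.sin (2 * Real.pi * (x + a * s))) * ha

lemma continuous_orbit (a x : ℝ) : Continuous (orbit a x) := by
  have := continuous_P
  unfold orbit
  fun_prop

lemma P_eq_zero_iff {x : ℝ} : P x = 0 ↔ ∃ j : ℤ, x = j := by
  have hpi := Real.pi_pos
  rw [P, div_eq_zero_iff, or_iff_left hpi.ne', sub_eq_zero, eq_comm, Real.cos_eq_one_iff]
  refine exists_congr fun n ↦ ⟨fun h ↦ ?_, fun h ↦ by rw [h]; ring⟩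
  have : 2 * Real.pi * (x - n) = 0 := by linarith
  have := (mul_eq_zero.1 this).resolve_left (by positivity)
  linarith

lemma P_intCast (j : ℤ) : P j = 0 := P_eq_zero_iff.2 ⟨j, rfl⟩

lemma P_pos {x : ℝ} (hx : ∀ j : ℤ, x ≠ j) : 0 < P x :=
  (P_nonneg x).lt_of_ne' fun h ↦ let ⟨j, hj⟩ := P_eq_zero_iff.1 h; hx j hj

lemma ne_intCast_of_mem_Ioo {x : ℝ} {n : ℤ} (h : x ∈ Ioo (n : ℝ) (n + 1)) (j : ℤ) : x ≠ j := by
  rintro rfl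
  have h1 : n < j := by exact_mod_cast h.1
  have h2 : j < n + 1 := by exact_mod_cast h.2
  omega

lemma lieDeriv_snd (X : ℝ × ℝ → ℝ × ℝ) (q : ℝ × ℝ) :
    lieDeriv field.f X q = (X q).2 := by
  change fderiv ℝ (fun q : ℝ × ℝ ↦ q.2) q (X q) = _
  rw [fderiv_snd]
  rfl

lemma vf_intCast (a : ℝ) (j : ℤ) : vf a ((j : ℝ), 0) = (a, 0) := by
  have : 2 * Real.pi * (j : ℝ) = (2 * j : ℤ) * Real.pi := by push_cast; ring
  simp only [vf, this, Real.sin_int_mul_pi, mul_zero]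

lemma visibleAt_fold (j : ℤ) : VisibleAt field.f field.Xp ((j : ℝ), 0) := by
  refine ⟨?_, 1, one_pos, orbit 1 j, ?_, ?_, ?_⟩
  · rw [lieDeriv_snd]
    exact congrArg Prod.snd (vf_intCast 1 j)
  · simp [orbit, P_intCast]
  · exact fun s _ ↦ (hasDerivAt_orbit (by norm_num) _ s).hasDerivWithinAt
  · intro s _
    change 0 ≤ 1 * P _
    rw [one_mul]
    exact P_nonneg _

/-- The orbit of `X⁺` through the fold is the graph of `P ≥ 0`, so the tangency is visible and hence
not singular. This is what allows a free choice of the outgoing field. -/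
lemma isRegularTangency_fold (j : ℤ) : field.IsRegularTangency ((j : ℝ), 0) := by
  have h1 : field.Xp ((j : ℝ), 0) = (1, 0) := vf_intCast 1 j
  have h2 : field.Xm ((j : ℝ), 0) = (-1, 0) := vf_intCast (-1) j
  refine ⟨⟨rfl, ?_, ?_, ?_⟩, fun h ↦ h.2.2.2.1 (visibleAt_fold j)⟩
  · simp [lieDeriv_snd, h1]
  · simp [h1]
  · simp [h2]

/-! ### Motion of an arbitrary trajectory -/

/-- A curve following `vf a` moves horizontally with velocity `a`. -/
lemma fst_eq {a : ℝ} {c : ℝ → ℝ × ℝ} {t ε : ℝ}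
    (h : IsIntegralCurveOn c (fun _ ↦ vf a) (Ico t (t + ε))) {τ : ℝ} (hτ : τ ∈ Ico t (t + ε)) :
    (c τ).1 = (c t).1 + a * (τ - t) := by
  have hd : ∀ x ∈ Ico t (t + ε),
      HasDerivWithinAt (fun s ↦ (c s).1 - a * s) 0 (Ico t (t + ε)) x := by
    intro x hx
    have h1 : HasDerivWithinAt (fun s ↦ (c s).1) a (Ico t (t + ε)) x := (h x hx).fst
    have h2 := h1.sub (((hasDerivAt_id x).const_mul a).hasDerivWithinAt (s := Ico t (t + ε)))
    exact h2.congr_deriv (by simp)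
  have := (convex_Ico t (t + ε)).norm_image_sub_le_of_norm_hasDerivWithin_le (C := 0) hd
    (by simp) ⟨le_rfl, hτ.1.trans_lt hτ.2⟩ hτ
  have h0 : (c τ).1 - a * τ - ((c t).1 - a * t) = 0 := by simpa using this
  linarith

/-- Two quantities pin the curve down: its uniform horizontal motion, and the conserved `y - a
P(x)`, which vanishes on `orbit a x`. -/
lemma eq_orbit {a : ℝ} (ha : a * a = 1) {c : ℝ → ℝ × ℝ} {t ε x s : ℝ}
    (h : IsIntegralCurveOn c (fun _ ↦ vf a) (Ico t (t + ε))) (hc : c t = orbit a x s)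
    {τ : ℝ} (hτ : τ ∈ Ico t (t + ε)) : c τ = orbit a x (s + (τ - t)) := by
  have h1 := fst_eq h hτ
  have h2 := conserved ha h hτ
  rw [hc] at h1 h2
  simp only [orbit] at h1 h2
  have h3 : (c τ).1 = x + a * (s + (τ - t)) := by rw [h1]; ring
  refine Prod.ext h3 ?_
  simp only [orbit]
  rw [← h3]
  linarith

/-- Continuous induction along a curve: a closed condition that persists for a short time after
each instant persists. -/
lemma mem_of_forward {c : ℝ → ℝ × ℝ} {a b : ℝ} (hc : ContinuousOn c (Icc a b))
    {K : Set (ℝ × ℝ × ℝ)} (hK : IsClosed K) (ha : (a, c a) ∈ K)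
    (hstep : ∀ τ ∈ Ico a b, (τ, c τ) ∈ K → ∃ ε > 0, ∀ σ ∈ Ico τ (τ + ε), (σ, c σ) ∈ K) :
    ∀ τ ∈ Icc a b, (τ, c τ) ∈ K := by
  have hcl : IsClosed ((fun τ ↦ (τ, c τ)) ⁻¹' K ∩ Icc a b) := by
    rw [inter_comm]
    exact (continuousOn_id.prodMk hc).preimage_isClosed_of_isClosed isClosed_Icc hK
  refine hcl.Icc_subset_of_forall_mem_nhdsWithin ha ?_
  rintro τ ⟨hτK, hτ⟩
  obtain ⟨ε, hε, h⟩ := hstep τ hτ hτK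
  exact mem_of_superset (Ioo_mem_nhdsGT (by linarith : τ < τ + ε)) fun σ hσ ↦ h σ ⟨hσ.1.le, hσ.2⟩

lemma continuousOn_curve {γ : ℝ≥0 → ℝ × ℝ} (hγ : field.IsPositiveGlobalTrajectory γ) {a b : ℝ}
    (ha : 0 ≤ a) : ContinuousOn (curve γ) (Icc a b) := fun x hx ↦
  (continuousWithinAt_of_local (ha.trans hx.1) (hγ x (ha.trans hx.1))).mono
    fun _ hy ↦ ha.trans hy.1

lemma abs_fst_sub_le_of_local {c : ℝ → ℝ × ℝ} {t : ℝ} (ht : 0 ≤ t)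
    (h : field.IsLocalTrajectoryAt c t) :
    ∃ ε > 0, ∀ τ ∈ Ico t (t + ε), |(c τ).1 - (c t).1| ≤ τ - t := by
  have key : ∀ a : ℝ, |a| = 1 → FollowsAfter (vf a) c t →
      ∃ ε > 0, ∀ τ ∈ Ico t (t + ε), |(c τ).1 - (c t).1| ≤ τ - t := by
    rintro a ha ⟨ε, hε, hc⟩
    refine ⟨ε, hε, fun τ hτ ↦ ?_⟩
    rw [fst_eq hc hτ, add_sub_cancel_left, abs_mul, ha, one_mul,
      abs_of_nonneg (sub_nonneg.2 hτ.1)]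
  have hp : FollowsAfter field.Xp c t → _ := key 1 (by norm_num)
  have hm : FollowsAfter field.Xm c t → _ := key (-1) (by norm_num)
  cases h with
  | upper h hb ha => exact hp ha
  | lower h hb ha => exact hm ha
  | crossingUp h _ _ hb ha => exact hp ha
  | crossingDown h _ _ hb ha => exact hm ha
  | regularTangency h hb ha => exact ha.elim hp hm
  | singularTangency h hc =>
    obtain ⟨ε, hε, hc⟩ := hc
    refine ⟨ε, hε, fun τ hτ ↦ ?_⟩
    rw [hc τ ⟨⟨by linarith [hτ.1], hτ.2⟩, ht.trans hτ.1⟩]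
    simpa using hτ.1

/-- The first coordinate of a trajectory is `1`-Lipschitz. -/
lemma abs_fst_sub_le {γ : ℝ≥0 → ℝ × ℝ} (hγ : field.IsPositiveGlobalTrajectory γ) {s t : ℝ}
    (hs : 0 ≤ s) (hst : s ≤ t) : |(curve γ t).1 - (curve γ s).1| ≤ t - s := by
  refine mem_of_forward (continuousOn_curve hγ hs)
    (K := {p | |p.2.1 - (curve γ s).1| ≤ p.1 - s})
    (isClosed_le (by fun_prop) (by fun_prop)) (by simp) ?_ t ⟨hst, le_rfl⟩
  intro τ hτ hτK
  obtain ⟨ε, hε, h⟩ := abs_fst_sub_le_of_local (hs.trans hτ.1) (hγ τ (hs.trans hτ.1))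
  refine ⟨ε, hε, fun σ hσ ↦ ?_⟩
  have h1 := h σ hσ
  simp only [mem_ofPred_eq] at hτK ⊢
  have h2 := abs_sub_le (curve γ σ).1 (curve γ τ).1 (curve γ s).1
  linarith

lemma followsAfter_of_pos {a : ℝ} (ha : a = 1 ∨ a = -1) {c : ℝ → ℝ × ℝ} {t : ℝ}
    (h : field.IsLocalTrajectoryAt c t) (hc : 0 < a * (c t).2) : FollowsAfter (vf a) c t := by
  have hne : ¬ (c t).2 = 0 := fun h0 ↦ by simp [h0] at hc
  rcases ha with rfl | rfl
  · cases h with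
    | upper h hb ha => exact ha
    | lower h hb ha => have h' : (c t).2 < 0 := h; linarith
    | crossingUp h _ _ hb ha => exact absurd h hne
    | crossingDown h _ _ hb ha => exact absurd h hne
    | regularTangency h hb ha => exact absurd h.1.1 hne
    | singularTangency h hc => exact absurd h.1.1 hne
  · cases h with
    | upper h hb ha => have h' : 0 < (c t).2 := h; linarith
    | lower h hb ha => exact ha
    | crossingUp h _ _ hb ha => exact absurd h hne
    | crossingDown h _ _ hb ha => exact absurd h hne
    | regularTangency h hb ha => exact absurd h.1.1 hne
    | singularTangency h hc => exact absurd h.1.1 hne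

lemma followsAfter_fold {c : ℝ → ℝ × ℝ} {t : ℝ} {j : ℤ}
    (h : field.IsLocalTrajectoryAt c t) (hc : c t = ((j : ℝ), 0)) :
    ∃ a : ℝ, (a = 1 ∨ a = -1) ∧ FollowsAfter (vf a) c t := by
  have h1 : field.Xp ((j : ℝ), 0) = (1, 0) := vf_intCast 1 j
  cases h with
  | upper h hb ha => exact ⟨1, .inl rfl, ha⟩
  | lower h hb ha => exact ⟨-1, .inr rfl, ha⟩
  | crossingUp h _ _ hb ha => exact ⟨1, .inl rfl, ha⟩
  | crossingDown h _ _ hb ha => exact ⟨-1, .inr rfl, ha⟩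
  | regularTangency h hb ha =>
    exact ha.elim (fun ha ↦ ⟨1, .inl rfl, ha⟩) fun ha ↦ ⟨-1, .inr rfl, ha⟩
  | singularTangency h _ => exact absurd h (hc ▸ (isRegularTangency_fold j).2)

/-- A trajectory that is at a fold at time `t` moves along one of the two orbits that leave the
fold. -/
lemma eq_orbit_of_fold {γ : ℝ≥0 → ℝ × ℝ} (hγ : field.IsPositiveGlobalTrajectory γ) {t : ℝ}
    (ht : 0 ≤ t) {j : ℤ} (hc : curve γ t = ((j : ℝ), 0)) :
    ∃ a : ℝ, (a = 1 ∨ a = -1) ∧ ∀ τ ∈ Icc t (t + 1), curve γ τ = orbit a j (τ - t) := by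
  obtain ⟨a, ha, hat⟩ := followsAfter_fold (hγ t ht) hc
  have haa : a * a = 1 := by rcases ha with rfl | rfl <;> norm_num
  refine ⟨a, ha, ?_⟩
  have hstart : curve γ t = orbit a j (t - t) := by simp [hc, orbit, P_intCast]
  refine mem_of_forward (continuousOn_curve hγ ht) (K := {p | p.2 = orbit a j (p.1 - t)})
    (isClosed_eq continuous_snd ((continuous_orbit a j).comp (by fun_prop))) hstart ?_
  intro τ hτ hτK
  have hτK : curve γ τ = orbit a j (τ - t) := hτK
  -- At time `t` this is the choice made at the fold. At later times before `t + 1` the orbit lies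
  -- strictly between two folds, so `a * y = P(x) > 0` and the field cannot change.
  have hfol : FollowsAfter (vf a) (curve γ) τ := by
    rcases hτ.1.eq_or_lt with rfl | hlt
    · exact hat
    · refine followsAfter_of_pos ha (hγ τ (ht.trans hτ.1)) ?_
      rw [hτK]
      simp only [orbit, ← mul_assoc, haa, one_mul]
      have h2 := hτ.2
      rcases ha with rfl | rfl
      · exact P_pos (ne_intCast_of_mem_Ioo (n := j) ⟨by linarith, by linarith⟩)
      · refine P_pos (ne_intCast_of_mem_Ioo (n := j - 1) ⟨?_, ?_⟩) <;> push_cast <;> linarith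
  obtain ⟨ε, hε, h⟩ := hfol
  refine ⟨ε, hε, fun σ hσ ↦ ?_⟩
  have := eq_orbit haa h hτK hσ
  rwa [show τ - t + (σ - τ) = σ - t by ring] at this

/-! ### Itineraries and the bound on their increments -/

lemma exists_mem_arc {q : ℝ × ℝ} (hq : q ∈ Lam) (hx : ∀ j : ℤ, q.1 ≠ j) : ∃ n, q ∈ arc n := by
  have h1 : (⌊q.1⌋ : ℝ) < q.1 := (Int.floor_le _).lt_of_ne' (hx _)
  have h2 := Int.lt_floor_add_one q.1
  rcases hq with hq | hq
  · refine ⟨2 * ⌊q.1⌋, ?_⟩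
    have e : 2 * ⌊q.1⌋ / 2 = ⌊q.1⌋ := by omega
    simp only [arc, e, mem_ofPred_eq, even_two_mul, if_true]
    exact ⟨h1, h2, hq⟩
  · refine ⟨2 * ⌊q.1⌋ + 1, ?_⟩
    have e : (2 * ⌊q.1⌋ + 1) / 2 = ⌊q.1⌋ := by omega
    have : ¬ Even (2 * ⌊q.1⌋ + 1) := Int.not_even_two_mul_add_one _
    simp only [arc, e, mem_ofPred_eq, this, if_false]
    exact ⟨h1, h2, hq⟩

lemma symbol_spec {p q : ℝ × ℝ} (h : (∃ n, p ∈ arc n) ∨ p ∈ folds ∧ ∃ m, q ∈ arc m) :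
    p ∈ arc (symbol p q) ∨ p ∈ folds ∧ q ∈ arc (symbol p q) := by
  unfold symbol
  split_ifs with h1 h2
  · exact .inl h1.choose_spec
  · exact .inr ⟨h2.1, h2.2.choose_spec⟩
  · exact absurd h (not_or.2 ⟨h1, h2⟩)

/-- The default value in `symbol` is never used: a point of `Λ∞` with integer abscissa is a fold,
and half a unit of time after a fold the trajectory is above or below the midpoint between two
neighbouring folds, hence on an arc. -/
lemma itinerary_spec (γ : Omega) (j : ℕ) :
    γ.1 j ∈ arc (itinerary γ j) ∨
      γ.1 j ∈ folds ∧ γ.1 (j + 1 / 2) ∈ arc (itinerary γ j) := by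
  refine symbol_spec ?_
  by_cases hx : ∀ l : ℤ, (γ.1 j).1 ≠ l
  · exact .inl (exists_mem_arc (mem_Lam γ.2 j) hx)
  push Not at hx
  obtain ⟨l, hl⟩ := hx
  have hy : (γ.1 j).2 = 0 := by
    rcases mem_Lam γ.2 j with h | h <;> simpa [hl, P_intCast] using h
  have hfold : γ.1 j = ((l : ℝ), 0) := Prod.ext hl hy
  refine .inr ⟨⟨l, hfold⟩, exists_mem_arc (mem_Lam γ.2 _) ?_⟩
  obtain ⟨a, ha, h⟩ := eq_orbit_of_fold γ.2.1 (t := j) (Nat.cast_nonneg j) (j := l)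
    (by simpa [curve] using hfold)
  have h1 := h (j + 1 / 2) ⟨by linarith, by linarith⟩
  have e : ((j : ℝ) + 1 / 2).toNNReal = (j : ℝ≥0) + 1 / 2 := by
    rw [← NNReal.coe_inj, Real.coe_toNNReal _ (by positivity)]
    simp
  rw [curve, e] at h1
  rw [h1]
  simp only [orbit]
  rcases ha with rfl | rfl
  · exact ne_intCast_of_mem_Ioo (n := l) ⟨by linarith, by linarith⟩
  · refine ne_intCast_of_mem_Ioo (n := l - 1) ⟨?_, ?_⟩ <;> push_cast <;> linarith

lemma NNReal_abs_fst_sub_le (γ : Omega) (t s : ℝ≥0) :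
    |(γ.1 (t + s)).1 - (γ.1 t).1| ≤ s := by
  simpa [curve] using abs_fst_sub_le γ.2.1 t.2 (le_add_of_nonneg_right (a := (t : ℝ)) s.2)

lemma itinerary_fst_bounds (γ : Omega) (j : ℕ) :
    ((itinerary γ j / 2 : ℤ) : ℝ) - 1 / 2 < (γ.1 j).1 ∧
      (γ.1 j).1 < ((itinerary γ j / 2 : ℤ) : ℝ) + 3 / 2 := by
  -- In the fold case the arc is read off half a unit of time later, which costs at most `1 / 2` on
  -- either side.
  rcases itinerary_spec γ j with h | ⟨-, h⟩
  · exact ⟨by linarith [h.1], by linarith [h.2.1]⟩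
  · have h1 := abs_le.1 (NNReal_abs_fst_sub_le γ j (1 / 2))
    simp only [NNReal.coe_div, NNReal.coe_one, NNReal.coe_ofNat] at h1
    exact ⟨by linarith [h.1, h1.2], by linarith [h.2.1, h1.1]⟩

lemma itinerary_succ_sub_mem (γ : Omega) (j : ℕ) :
    itinerary γ (j + 1) - itinerary γ j ∈ Finset.Icc (-5 : ℤ) 5 := by
  have h1 := itinerary_fst_bounds γ j
  have h2 := itinerary_fst_bounds γ (j + 1)
  have h3 := abs_le.1 (NNReal_abs_fst_sub_le γ j 1)
  push_cast at h2 h3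
  generalize hm : itinerary γ j / 2 = m at h1
  generalize hn : itinerary γ (j + 1) / 2 = n at h2
  -- The halved symbols differ by at most `2`, and the parities add at most `1`: in total `2 * 2 + 1
  -- = 5`.
  have h4 : n < m + 3 := by
    have : (n : ℝ) < m + 3 := by linarith [h1.2, h2.1, h3.2]
    exact_mod_cast this
  have h5 : m < n + 3 := by
    have : (m : ℝ) < n + 3 := by linarith [h1.1, h2.2, h3.1]
    exact_mod_cast this
  rw [Finset.mem_Icc]
  omega

/-- Consecutive symbols of an itinerary have bounded distance. -/
lemma isLabelling_subgraph (W : Set OmegaBar) :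
    (subgraph W).IsLabelling (fun a b ↦ b - a) (Finset.Icc (-5) 5) where
  mem := by
    rintro _ _ ⟨⟨γ, j, rfl, rfl⟩, -⟩
    exact itinerary_succ_sub_mem γ j
  injective _ _ h := by simpa using h

lemma log_card_lt_top (S : Finset ℤ) : ENNReal.log S.card < ⊤ :=
  ENNReal.log_lt_top_iff.2 (ENNReal.natCast_lt_top _)

lemma entropy_lt_top (W : Set OmegaBar) : entropy W < ⊤ :=
  (isLabelling_subgraph W).gurevichEntropy_le.trans_lt (log_card_lt_top _)

lemma gurevichPressure_subgraph_lt_top (W : Set OmegaBar) (a : ℤ) :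
    (subgraph W).gurevichPressure (fun _ ↦ 0) a < ⊤ :=
  ((isLabelling_subgraph W).gurevichPressure_zero_le a).trans_lt (log_card_lt_top _)

/-- Over an open unit interval `P > 0`, so the graphs of `P` and `-P` are disjoint there. -/
lemma arc_unique {q : ℝ × ℝ} {m n : ℤ} (hm : q ∈ arc m) (hn : q ∈ arc n) : m = n := by
  obtain ⟨hm1, hm2, hm3⟩ := hm
  obtain ⟨hn1, hn2, hn3⟩ := hn
  have hpos := P_pos (ne_intCast_of_mem_Ioo ⟨hm1, hm2⟩)
  have h1 : m / 2 < n / 2 + 1 := by exact_mod_cast hm1.trans hn2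
  have h2 : n / 2 < m / 2 + 1 := by exact_mod_cast hn1.trans hm2
  rw [hm3] at hn3
  split_ifs at hn3 with h3 h4 h4
  · rw [Int.even_iff] at h3 h4; omega
  · linarith
  · linarith
  · rw [Int.even_iff] at h3 h4; omega

/-! ### Trajectories that follow a prescribed walk on the folds -/

/-- The velocity, during the `k`-th unit of time, of a trajectory that visits the folds
`(X k, 0)`. -/
noncomputable def velocity (X : ℕ → ℤ) (k : ℕ) : ℝ := (X (k + 1) : ℝ) - X k

/-- The curve in `Λ∞` that is at the fold `(X k, 0)` at each time `k`. -/
noncomputable def foldPath (X : ℕ → ℤ) (t : ℝ≥0) : ℝ × ℝ :=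
  orbit (velocity X ⌊(t : ℝ)⌋₊) (X ⌊(t : ℝ)⌋₊) (t - ⌊(t : ℝ)⌋₊)

lemma foldPath_natCast (X : ℕ → ℤ) (k : ℕ) : foldPath X k = ((X k : ℝ), 0) := by
  simp [foldPath, orbit, P_intCast]

lemma curve_foldPath (X : ℕ → ℤ) {k : ℕ} {t : ℝ} (ht : t ∈ Icc (k : ℝ) (k + 1)) :
    curve (foldPath X) t = orbit (velocity X k) (X k) (t - k) := by
  have h0 : 0 ≤ t := (Nat.cast_nonneg k).trans ht.1
  rcases ht.2.lt_or_eq with hlt | rfl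
  · have hfl : ⌊t⌋₊ = k := (Nat.floor_eq_iff h0).2 ⟨ht.1, hlt⟩
    simp only [curve, foldPath, Real.coe_toNNReal _ h0, hfl]
  · have e : ((k : ℝ) + 1).toNNReal = (k + 1 : ℕ) := by
      rw [← NNReal.coe_inj, Real.coe_toNNReal _ h0]
      simp
    rw [curve, e, foldPath_natCast]
    simp [orbit, velocity, P_intCast]

lemma velocity_eq {X : ℕ → ℤ} (hX : ∀ k, X (k + 1) = X k + 1 ∨ X (k + 1) = X k - 1) (k : ℕ) :
    velocity X k = 1 ∨ velocity X k = -1 := by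
  rcases hX k with h | h
  · left; simp [velocity, h]
  · right; simp [velocity, h]

lemma isIntegralCurveOn_foldPath {X : ℕ → ℤ}
    (hX : ∀ k, X (k + 1) = X k + 1 ∨ X (k + 1) = X k - 1) (k : ℕ) :
    IsIntegralCurveOn (curve (foldPath X)) (fun _ ↦ vf (velocity X k))
      (Icc (k : ℝ) (k + 1)) := by
  intro t ht
  have ha : velocity X k * velocity X k = 1 := by
    rcases velocity_eq hX k with h | h <;> rw [h] <;> norm_num
  have h1 : HasDerivAt (fun s ↦ orbit (velocity X k) (X k) (s - k))
      (vf (velocity X k) (orbit (velocity X k) (X k) (t - k))) t :=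
    (hasDerivAt_orbit ha _ _).comp_sub_const t k
  have h2 := h1.hasDerivWithinAt.congr (fun s hs ↦ curve_foldPath X hs) (curve_foldPath X ht)
  rwa [← curve_foldPath X ht] at h2

lemma followsAfter_foldPath {X : ℕ → ℤ}
    (hX : ∀ k, X (k + 1) = X k + 1 ∨ X (k + 1) = X k - 1) {k : ℕ} {t : ℝ}
    (ht : t ∈ Ico (k : ℝ) (k + 1)) :
    FollowsAfter (vf (velocity X k)) (curve (foldPath X)) t :=
  ⟨k + 1 - t, sub_pos.2 ht.2, (isIntegralCurveOn_foldPath hX k).mono fun s hs ↦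
    ⟨ht.1.trans hs.1, by linarith [hs.2]⟩⟩

lemma followsBefore_foldPath {X : ℕ → ℤ}
    (hX : ∀ k, X (k + 1) = X k + 1 ∨ X (k + 1) = X k - 1) {k : ℕ} {t : ℝ}
    (ht : t ∈ Ioc (k : ℝ) (k + 1)) :
    FollowsBefore (vf (velocity X k)) (curve (foldPath X)) t :=
  ⟨t - k, sub_pos.2 ht.1, (isIntegralCurveOn_foldPath hX k).mono fun s hs ↦
    ⟨by linarith [hs.1.1], hs.1.2.trans ht.2⟩⟩

/-- Only nonnegative times count, so the condition concerns the single time `0`, where it is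
vacuous. -/
lemma followsBefore_zero (Y : ℝ × ℝ → ℝ × ℝ) (c : ℝ → ℝ × ℝ) : FollowsBefore Y c 0 := by
  refine ⟨1, one_pos, ?_⟩
  have : Ioc (0 - 1 : ℝ) 0 ∩ Ici 0 = {0} := by
    ext s
    simp only [mem_inter_iff, mem_Ioc, mem_Ici, mem_singleton_iff]
    exact ⟨fun h ↦ le_antisymm h.1.2 h.2, fun h ↦ by simp [h]⟩
  rw [this]
  rintro s rfl
  exact HasFDerivWithinAt.of_subsingleton subsingleton_singleton

/-- At integer times the curve is at a fold, a regular tangency, where any incoming field may be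
followed by any outgoing one. In between it is off the switching manifold: above when moving right,
below when moving left. -/
lemma foldPath_mem_Omega {X : ℕ → ℤ} (hX : ∀ k, X (k + 1) = X k + 1 ∨ X (k + 1) = X k - 1) :
    foldPath X ∈ Omega := by
  refine ⟨fun t ht ↦ ?_, ?_⟩
  · have hk1 := Nat.floor_le ht
    have hk2 := Nat.lt_floor_add_one t
    generalize ⌊t⌋₊ = k at hk1 hk2
    have hafter := followsAfter_foldPath hX ⟨hk1, hk2⟩
    have hcurve := curve_foldPath X ⟨hk1, hk2.le⟩
    rcases hk1.eq_or_lt with rfl | hlt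
    · refine .regularTangency ?_ ?_ ?_
      · rw [hcurve]
        simpa [orbit, P_intCast] using isRegularTangency_fold (X k)
      -- The incoming field is that of the previous unit of time; at time `0` there is none.
      · rcases k with _ | k
        · left
          simpa using followsBefore_zero _ _
        · have hb := followsBefore_foldPath hX (k := k) (t := (k + 1 : ℕ))
            ⟨by push_cast; linarith, by push_cast; rfl⟩
          rcases velocity_eq hX k with h | h <;> rw [h] at hb
          · exact .inl hb
          · exact .inr hb
      · rcases velocity_eq hX k with h | h <;> rw [h] at hafter
        · exact .inl hafter
        · exact .inr hafter
    · have hb := followsBefore_foldPath hX (k := k) ⟨hlt, hk2.le⟩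
      rcases velocity_eq hX k with h | h <;> rw [h] at hafter hb hcurve
      · refine .upper ?_ hb hafter
        change 0 < (curve (foldPath X) t).2
        rw [hcurve]
        have := P_pos (x := X k + 1 * (t - k))
          (ne_intCast_of_mem_Ioo (n := X k) ⟨by linarith, by linarith⟩)
        simpa [orbit] using this
      · refine .lower ?_ hb hafter
        change (curve (foldPath X) t).2 < 0
        rw [hcurve]
        have := P_pos (x := X k + -1 * (t - k)) (ne_intCast_of_mem_Ioo (n := X k - 1)
          ⟨by push_cast; linarith, by push_cast; linarith⟩)
        simp only [orbit]
        linarith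
  · have := foldPath_natCast X 0
    rw [Nat.cast_zero] at this
    rw [this]
    exact .inl (P_intCast _).symm

lemma symbol_eq_of_fold {j n : ℤ} {q : ℝ × ℝ} (hq : q ∈ arc n) : symbol ((j : ℝ), 0) q = n := by
  have h1 : ¬ ∃ m, ((j : ℝ), (0 : ℝ)) ∈ arc m := fun ⟨m, hm⟩ ↦
    ne_intCast_of_mem_Ioo ⟨hm.1, hm.2.1⟩ j rfl
  have h2 : ((j : ℝ), (0 : ℝ)) ∈ folds ∧ ∃ m, q ∈ arc m := ⟨⟨j, rfl⟩, n, hq⟩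
  rw [symbol, dif_neg h1, dif_pos h2]
  exact arc_unique h2.2.choose_spec hq

lemma foldPath_add_half (X : ℕ → ℤ) (k : ℕ) :
    foldPath X (k + 1 / 2) = orbit (velocity X k) (X k) (1 / 2) := by
  have h := curve_foldPath X (k := k) (t := ((k + 1 / 2 : ℝ≥0) : ℝ))
    ⟨by simp, by push_cast; linarith⟩
  rwa [curve, Real.toNNReal_coe, NNReal.coe_add, NNReal.coe_natCast, add_sub_cancel_left,
    NNReal.coe_div, NNReal.coe_one, NNReal.coe_ofNat] at h

/-- The index of the arc along which trajectories move from the fold `(x, 0)` to the neighbouring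
fold `(y, 0)`. -/
def moveArc (x y : ℤ) : ℤ := if y = x + 1 then 2 * x else 2 * y + 1

lemma itinerary_foldPath {X : ℕ → ℤ} (hX : ∀ k, X (k + 1) = X k + 1 ∨ X (k + 1) = X k - 1)
    (k : ℕ) : itinerary ⟨foldPath X, foldPath_mem_Omega hX⟩ k = moveArc (X k) (X (k + 1)) := by
  change symbol (foldPath X k) (foldPath X (k + 1 / 2)) = _
  rw [foldPath_natCast, foldPath_add_half]
  refine symbol_eq_of_fold ?_
  rcases hX k with h | h
  · have hv : velocity X k = 1 := by simp [velocity, h]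
    have e : moveArc (X k) (X (k + 1)) = 2 * X k := by simp [moveArc, h]
    have e' : 2 * X k / 2 = X k := by omega
    simp only [arc, e, e', mem_ofPred_eq, even_two_mul, if_true, hv, orbit, one_mul, and_true]
    constructor <;> linarith
  · have hv : velocity X k = -1 := by simp [velocity, h]
    have e : moveArc (X k) (X (k + 1)) = 2 * (X k - 1) + 1 := by
      rw [moveArc, if_neg (by omega), h]
    have e' : (2 * (X k - 1) + 1) / 2 = X k - 1 := by omega
    have : ¬ Even (2 * (X k - 1) + 1) := Int.not_even_two_mul_add_one _
    simp only [arc, e, e', mem_ofPred_eq, this, if_false, hv, orbit]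
    push_cast
    refine ⟨by linarith, by linarith, by ring⟩

/-! ### Strong connectivity of the graph -/

/-- Each pair of consecutive moves between neighbouring folds gives an edge of the graph of
`Z∞`. -/
lemma adj_of_moves {x y z : ℤ} (hxy : y = x + 1 ∨ y = x - 1) (hyz : z = y + 1 ∨ z = y - 1) :
    transitionGraph.Adj (moveArc x y) (moveArc y z) := by
  -- The walk `x, y, z`, continued forever in the direction of its second move.
  let X : ℕ → ℤ := fun k ↦ if k = 0 then x else y + (k - 1) * (z - y)
  have h1 : X 1 = y := by simp [X]
  have h2 : X 2 = z := by simp [X]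
  have hX : ∀ k, X (k + 1) = X k + 1 ∨ X (k + 1) = X k - 1 := by
    intro k
    rcases Nat.eq_zero_or_pos k with rfl | hk
    · simpa [X] using hxy
    · have e : X (k + 1) = X k + (z - y) := by simp [X, hk.ne']; ring
      omega
  refine ⟨⟨foldPath X, foldPath_mem_Omega hX⟩, 0, ?_, ?_⟩
  · rw [itinerary_foldPath hX, zero_add, h1]
    rfl
  · rw [itinerary_foldPath hX, zero_add, h1, h2]

lemma moveArc_right (j : ℤ) : moveArc j (j + 1) = 2 * j := if_pos rfl

lemma moveArc_left (j : ℤ) : moveArc (j + 1) j = 2 * j + 1 := if_neg (by omega)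

lemma adj_right (j : ℤ) : transitionGraph.Adj (2 * j) (2 * (j + 1)) := by
  rw [← moveArc_right, ← moveArc_right]
  exact adj_of_moves (.inl rfl) (.inl rfl)

lemma adj_left (j : ℤ) : transitionGraph.Adj (2 * (j + 1) + 1) (2 * j + 1) := by
  rw [← moveArc_left, ← moveArc_left]
  exact adj_of_moves (.inr (by ring)) (.inr (by ring))

lemma adj_down (j : ℤ) : transitionGraph.Adj (2 * j) (2 * j + 1) := by
  rw [← moveArc_left, ← moveArc_right]
  exact adj_of_moves (.inl rfl) (.inr (by ring))

lemma adj_up (j : ℤ) : transitionGraph.Adj (2 * j + 1) (2 * j) := by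
  rw [← moveArc_left, ← moveArc_right]
  exact adj_of_moves (.inr (by ring)) (.inl rfl)

open Relation in
lemma reflTransGen_even (j : ℤ) : ReflTransGen transitionGraph.Adj 0 (2 * j) ∧
    ReflTransGen transitionGraph.Adj (2 * j) 0 := by
  -- Upper arcs lead only to the right, so the way back drops to the lower arc, moves left and rises
  -- again.
  have hstep : ∀ j, ReflTransGen transitionGraph.Adj (2 * (j + 1)) (2 * j) := fun j ↦
    ((ReflTransGen.single (adj_down (j + 1))).tail (adj_left j)).tail (adj_up j)
  have hstep' : ∀ j, ReflTransGen transitionGraph.Adj (2 * j) (2 * (j + 1)) := fun j ↦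
    .single (adj_right j)
  induction j with
  | zero => exact ⟨.refl, .refl⟩
  | succ j ih => exact ⟨ih.1.trans (hstep' j), (hstep j).trans ih.2⟩
  | pred j ih =>
    have h1 := hstep (-(j : ℤ) - 1)
    have h2 := hstep' (-(j : ℤ) - 1)
    rw [sub_add_cancel] at h1 h2
    exact ⟨ih.1.trans h1, h2.trans ih.2⟩

open Relation in
lemma transitionGraph_transGen (a b : ℤ) : TransGen transitionGraph.Adj a b := by
  have h1 : TransGen transitionGraph.Adj a 0 := by
    rcases Int.even_or_odd' a with ⟨j, rfl | rfl⟩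
    -- The detour down and up ensures positive length even when `a = 0`.
    · exact ((TransGen.single (adj_down j)).tail (adj_up j)).trans_left (reflTransGen_even j).2
    · exact (TransGen.single (adj_up j)).trans_left (reflTransGen_even j).2
  refine h1.trans_left ?_
  rcases Int.even_or_odd' b with ⟨j, rfl | rfl⟩
  · exact (reflTransGen_even j).1
  · exact (reflTransGen_even j).1.tail (adj_down j)

lemma subgraph_univ_adj {a b : ℤ} (h : transitionGraph.Adj a b) : (subgraph univ).Adj a b :=
  ⟨h, let ⟨γ, j, ha, _⟩ := h; ⟨Quotient.mk _ γ, mem_univ _, j, ha⟩,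
    let ⟨γ, j, _, hb⟩ := h; ⟨Quotient.mk _ γ, mem_univ _, j + 1, hb⟩⟩

/-- The graph of all itineraries of `Z∞` is strongly connected. -/
lemma subgraph_univ_isTransitive : (subgraph univ).IsTransitive := fun a _ b _ ↦
  Relation.TransGen.mono (fun _ _ ↦ subgraph_univ_adj) _ _ (transitionGraph_transGen a b)

lemma univ_nonempty_OmegaBar : (univ : Set OmegaBar).Nonempty :=
  let ⟨γ, _⟩ := adj_right 0
  ⟨Quotient.mk _ γ, mem_univ _⟩

end ZInf

theorem mainTheorem10 :
    (∀ W : Set ZInf.OmegaBar,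
      ZInf.entropy W < ⊤ ∧
      ∀ a ∈ (ZInf.subgraph W).verts,
        (ZInf.subgraph W).gurevichPressure (fun _ ↦ 0) a < ⊤) ∧
    ∃ W : Set ZInf.OmegaBar,
      W.Nonempty ∧ MapsTo ZInf.timeOneBar W W ∧ (ZInf.subgraph W).IsTransitive ∧
      ZInf.entropy W < ⊤ :=
  ⟨fun W ↦ ⟨ZInf.entropy_lt_top W, fun a _ ↦ ZInf.gurevichPressure_subgraph_lt_top W a⟩,
    univ, ZInf.univ_nonempty_OmegaBar, mapsTo_univ _ _, ZInf.subgraph_univ_isTransitive,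
    ZInf.entropy_lt_top univ⟩
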